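/- Let $\rho$ be a Borel probability measure on $\mathbb R$ and $s\in[1,+\infty)$ such that $\int_{\mathbb R}|y|^s\,d\rho(y)<+\infty$ and $\int_{\mathbb R}y\,d\rho(y)<0$. Let $(Y_n)_{n\geq 1}$ be i.i.d. random variables with law $\rho$ and, for $x\in\mathbb R_+=[0,+\infty)$, let $(X_n)_{n\ge 0}$ be the reflected random walk started at $x$, that is $X_0=x$ and $X_{n+1}=\max(X_n+Y_{n+1},0)$; write $\mathbb E_x$ for the expectation when the walk starts at $x$. Let $Pf(x)=\int_{\mathbb R} f(\max(x+y,0))\,d\rho(y)$ be its Markov operator, let $\tau=\inf\{n\geq 1:\ X_{n-1}+Y_n\leq 0\}$ (with $\inf\emptyset=+\infty$), and put $$Rf(x)=\mathbb E_x\Big[\mathbf 1_{\{\tau<+\infty\}}\sum_{k=0}^{\tau-1}f(X_k)\Big],\qquad \mu(A)=\frac{1}{\mathbb E_0\tau}\,\mathbb E_0\Big[\sum_{0\leq k<\tau}\mathbf 1_A(X_k)\Big].$$ For $t\geq 0$ let $u_t(x)=1+x^t$ on $\mathbb R_+$, and for $v:\mathbb R_+\to[1,+\infty)$ let $\mathcal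 F^1_v$ be the space of Borel functions $f:\mathbb R_+\to\mathbb R$ such that $\sup_{x}|f(x)|/v(x)<+\infty$. Then $\mu$ is a $P$-invariant probability measure on $\mathbb R_+$ and, for every $f\in\mathcal F^1_{u_{s-1}}$, the function $f$ is $\mu$-integrable, and there is $g\in\mathcal F^1_{u_s}$ such that $$f=g-Pg+\int f\,d\mu\quad\text{everywhere on }\mathbb R_+,$$ the integrals defining $Pg(x)$ being absolutely convergent for every $x\in\mathbb R_+$. Moreover one can take $g=R\big(f-\int f\,d\mu\big)$, where $R\big|f-\int f\,d\mu\big|$ is finite everywhere on $\mathbb R_+$. -/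

import Mathlib

open MeasureTheory ProbabilityTheory
open scoped NNReal ENNReal

namespace ReflectedWalk

/-- One step of the walk: `max (x + y, 0)`, as a point of the half line. -/
noncomputable def step (x : ℝ≥0) (y : ℝ) : ℝ≥0 := Real.toNNReal ((x : ℝ) + y)

theorem coe_step (x : ℝ≥0) (y : ℝ) : (step x y : ℝ) = max ((x : ℝ) + y) 0 :=
  Real.coe_toNNReal' _

theorem measurable_step : Measurable (fun p : ℝ≥0 × ℝ => step p.1 p.2) := by
  unfold step
  fun_prop

/-- The transition kernel: from `x`, the chain moves to `max (x + Y, 0)` where `Y` has law `ρ`. -/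
noncomputable def kernel (ρ : Measure ℝ) [IsProbabilityMeasure ρ] : Kernel ℝ≥0 ℝ≥0 where
  toFun x := ρ.map (step x)
  measurable' := by
    refine Measure.measurable_of_measurable_coe _ fun s hs => ?_
    have h : ∀ x : ℝ≥0, Measurable (step x) := fun x =>
      measurable_step.comp measurable_prodMk_left
    have e : (fun x : ℝ≥0 => ρ.map (step x) s) = fun x => ρ (step x ⁻¹' s) :=
      funext fun x => Measure.map_apply (h x) hs
    rw [e]
    exact measurable_measure_prodMk_left (measurable_step hs)

/-- The Markov operator `P f (x) = E [f (X₁) | X₀ = x]`. -/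
noncomputable def P (ρ : Measure ℝ) [IsProbabilityMeasure ρ] (f : ℝ≥0 → ℝ) (x : ℝ≥0) : ℝ :=
  ∫ z, f z ∂(kernel ρ x)

/-- The law `ρ^{⊗ ℕ}` of the sequence of increments. -/
noncomputable def incrLaw (ρ : Measure ℝ) [IsProbabilityMeasure ρ] : Measure (ℕ → ℝ) :=
  Measure.infinitePi fun _ : ℕ => ρ

/-- The walk started at `x` with increments `Y₁ = y 0`, `Y₂ = y 1`, ...:
`X₀ = x` and `Xₙ₊₁ = max (Xₙ + Yₙ₊₁, 0)`. -/
noncomputable def walk (x : ℝ≥0) (y : ℕ → ℝ) : ℕ → ℝ≥0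
  | 0 => x
  | n + 1 => step (walk x y n) (y n)

theorem measurable_walk (x : ℝ≥0) (n : ℕ) : Measurable fun y : ℕ → ℝ => walk x y n := by
  induction n with
  | zero => exact measurable_const
  | succ n ih => exact measurable_step.comp (ih.prodMk (measurable_pi_apply n))

/-- The stopping time `τ = inf {m ≥ 1 | Xₘ₋₁ + Yₘ ≤ 0}` of the walk started at `x`, equal to `⊤`
if there is no such `m` (here `m = n + 1` and `Yₘ = y n`). -/
noncomputable def tau (x : ℝ≥0) (y : ℕ → ℝ) : ℕ∞ :=
  sInf {m : ℕ∞ | ∃ n : ℕ, m = (n : ℕ∞) + 1 ∧ (walk x y n : ℝ) + y n ≤ 0}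

/-- `f (X₀) + ... + f (X_{τ - 1})`, for the walk started at `x`, meant on the event `τ < ∞`. -/
noncomputable def excursionSum (f : ℝ≥0 → ℝ) (x : ℝ≥0) (y : ℕ → ℝ) : ℝ :=
  ∑ k ∈ Finset.range (tau x y).toNat, f (walk x y k)

/-- `R f (x) = ∫_{τ < ∞} (f (X₀) + ... + f (X_{τ - 1})) dP_x`. -/
noncomputable def R (ρ : Measure ℝ) [IsProbabilityMeasure ρ] (f : ℝ≥0 → ℝ) (x : ℝ≥0) : ℝ :=
  ∫ y in {y : ℕ → ℝ | tau x y < ⊤}, excursionSum f x y ∂(incrLaw ρ)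

/-- `R f` is defined by absolutely convergent integrals at every starting point,
that is, `R |f|` is everywhere finite. -/
def RDefined (ρ : Measure ℝ) [IsProbabilityMeasure ρ] (f : ℝ≥0 → ℝ) : Prop :=
  ∀ x : ℝ≥0, IntegrableOn (excursionSum (fun z => |f z|) x) {y : ℕ → ℝ | tau x y < ⊤} (incrLaw ρ)

/-- The measure `μ (A) = (E₀ τ)⁻¹ E₀ ∑_{0 ≤ k < τ} 1_A (Xₖ)`. -/
noncomputable def mu (ρ : Measure ℝ) [IsProbabilityMeasure ρ] : Measure ℝ≥0 :=
  (∫⁻ y, (tau 0 y : ℝ≥0∞) ∂(incrLaw ρ))⁻¹ •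
    Measure.sum fun k : ℕ =>
      ((incrLaw ρ).restrict {y : ℕ → ℝ | (k : ℕ∞) < tau 0 y}).map fun y => walk 0 y k

/-- The space `F_v^p` of Borel functions `f` with `sup |f|^p / v` finite. -/
def weightedSpace {X : Type*} [MeasurableSpace X] (p : ℝ) (v : X → ℝ) : Set (X → ℝ) :=
  {f | Measurable f ∧ BddAbove (Set.range fun x => |f x| ^ p / v x)}

/-- The weight `u_s (x) = 1 + x ^ s` on the half line. -/
noncomputable def u (s : ℝ) (x : ℝ≥0) : ℝ := 1 + (x : ℝ) ^ s

end ReflectedWalk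

/-! Let `K` be the transition operator of the walk killed at `τ` (`killed`), `G = ∑ K^k` its
potential (`green`), and `p x` the probability of stepping from `x` to `0`. Then `P f = K f + f(0)
p`, `R f = G f`, and `μ f = G f (0) / E₀ τ`.

Since `G = I + K G`, one gets `P G f = G f - f + G f (0) p` (`lintegral_kernel_green`). If `μ f = 0`
the last term vanishes and `g = G f` solves the Poisson equation. Invariance of `μ` follows from `G
= I + G K` and `G p = 1`.

Finiteness comes from a Lyapunov function. As `E Y < 0`, one step from a large `z` lowers the mean
of `z^s` by at least `c z^(s-1)` (`exists_drift`). A translate of `z^s` is then a supersolution for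
the killed walk, so `G u_{s-1} ≤ C u_s` (`exists_green_le`).

Potentials are handled in `ℝ≥0∞`; signed functions enter through their positive and negative parts.
-/

namespace ReflectedWalk

/-! ### The first step decomposition of the increments -/

/-- The sequence `y, w 0, w 1, ...`. -/
def prepend (y : ℝ) (w : ℕ → ℝ) : ℕ → ℝ
  | 0 => y
  | n + 1 => w n

theorem measurable_prepend : Measurable fun p : ℝ × (ℕ → ℝ) => prepend p.1 p.2 := by
  refine measurable_pi_iff.2 fun n => ?_
  cases n with
  | zero => exact measurable_fst
  | succ n => exact (measurable_pi_apply n).comp measurable_snd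

instance (ρ : Measure ℝ) [IsProbabilityMeasure ρ] : IsProbabilityMeasure (incrLaw ρ) := by
  unfold incrLaw
  infer_instance

/-- This is the Markov property at time one: the first increment can be integrated out separately.
It is checked on cylinders, which determine the infinite product. -/
theorem measurePreserving_prepend (ρ : Measure ℝ) [IsProbabilityMeasure ρ] :
    MeasurePreserving (fun p : ℝ × (ℕ → ℝ) => prepend p.1 p.2)
      (ρ.prod (incrLaw ρ)) (incrLaw ρ) := by
  refine ⟨measurable_prepend, ?_⟩
  refine Measure.eq_infinitePi (fun _ : ℕ => ρ) fun s t ht => ?_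
  classical
  rw [Measure.map_apply measurable_prepend
    (MeasurableSet.pi s.countable_toSet fun i _ => ht i)]
  have hpre : (fun p : ℝ × (ℕ → ℝ) => prepend p.1 p.2) ⁻¹' Set.pi s t =
      (if 0 ∈ s then t 0 else Set.univ) ×ˢ
        Set.pi (s.preimage Nat.succ Nat.succ_injective.injOn : Finset ℕ)
          fun n => t (n + 1) := by
    ext ⟨y, w⟩
    simp only [Set.mem_preimage, Set.mem_pi, Set.mem_prod, Finset.coe_preimage, Finset.mem_coe]
    constructor
    · intro h
      refine ⟨?_, fun n hn => h (n + 1) hn⟩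
      split_ifs with h0
      · exact h 0 h0
      · trivial
    · rintro ⟨h0, h⟩ (_ | n) hn
      · rw [if_pos hn] at h0
        exact h0
      · exact h n hn
  rw [hpre, Measure.prod_prod, incrLaw, Measure.infinitePi_pi _ fun i _ => ht (i + 1)]
  have hprod := Finset.prod_preimage' Nat.succ s Nat.succ_injective.injOn fun i => ρ (t i)
  have hfilter : (s.filter fun i => i ∈ Set.range Nat.succ) = s.erase 0 := by
    ext (_ | i) <;> simp
  rw [hfilter] at hprod
  simp only [Nat.succ_eq_add_one] at hprod
  rw [hprod]
  split_ifs with h0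
  · exact Finset.mul_prod_erase s (fun i => ρ (t i)) h0
  · rw [measure_univ, one_mul, Finset.erase_eq_of_notMem h0]

theorem walk_prepend (x : ℝ≥0) (y : ℝ) (w : ℕ → ℝ) (k : ℕ) :
    walk x (prepend y w) (k + 1) = walk (step x y) w k := by
  induction k with
  | zero => rfl
  | succ k ih =>
    rw [walk, ih]
    rfl

theorem lt_tau_iff (x : ℝ≥0) (y : ℕ → ℝ) (k : ℕ) :
    (k : ℕ∞) < tau x y ↔ ∀ n < k, 0 < (walk x y n : ℝ) + y n := by
  constructor
  · intro h n hn
    by_contra hle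
    have h1 : tau x y ≤ (n : ℕ∞) + 1 := sInf_le ⟨n, rfl, not_lt.1 hle⟩
    have h2 : (n : ℕ∞) + 1 ≤ k := by exact_mod_cast hn
    exact absurd h (not_lt.2 (h1.trans h2))
  · intro h
    have h1 : ((k + 1 : ℕ) : ℕ∞) ≤ tau x y := by
      refine le_sInf ?_
      rintro m ⟨n, rfl, hn⟩
      have : k ≤ n := by
        by_contra hk
        exact absurd (h n (not_le.1 hk)) (not_lt.2 hn)
      exact_mod_cast Nat.succ_le_succ this
    exact lt_of_lt_of_le (by exact_mod_cast Nat.lt_succ_self k) h1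

theorem lt_tau_prepend (x : ℝ≥0) (y : ℝ) (w : ℕ → ℝ) (k : ℕ) :
    ((k + 1 : ℕ) : ℕ∞) < tau x (prepend y w) ↔
      0 < (x : ℝ) + y ∧ (k : ℕ∞) < tau (step x y) w := by
  rw [lt_tau_iff, lt_tau_iff, Nat.forall_lt_succ_left]
  refine and_congr Iff.rfl ?_
  simp only [walk_prepend]
  rfl

theorem measurableSet_lt_tau (x : ℝ≥0) (k : ℕ) :
    MeasurableSet {y : ℕ → ℝ | (k : ℕ∞) < tau x y} := by
  simp only [lt_tau_iff, Set.ofPred_forall]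
  refine MeasurableSet.iInter fun n => MeasurableSet.iInter fun _ => ?_
  exact measurableSet_lt measurable_const
    ((measurable_walk x n).coe_nnreal_real.add (measurable_pi_apply n))

theorem measurable_tau (x : ℝ≥0) : Measurable (tau x) := by
  refine ENat.measurable_iff.2 fun n => ?_
  have h : tau x ⁻¹' {(n : ℕ∞)} =
      {y | (n : ℕ∞) < tau x y}ᶜ ∩ ⋂ k ∈ Finset.range n, {y | (k : ℕ∞) < tau x y} := by
    ext y
    simp only [Set.mem_preimage, Set.mem_singleton_iff, Set.mem_inter_iff, Set.mem_compl_iff,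
      Set.mem_ofPred_eq, not_lt, Finset.mem_range, Set.mem_iInter]
    constructor
    · intro h
      rw [h]
      exact ⟨le_rfl, fun k hk => by exact_mod_cast hk⟩
    · rintro ⟨h1, h2⟩
      refine le_antisymm h1 ?_
      cases n with
      | zero => simp
      | succ n =>
        have := Order.add_one_le_of_lt (h2 n n.lt_succ_self)
        exact_mod_cast this
  rw [h]
  exact (measurableSet_lt_tau x n).compl.inter
    (MeasurableSet.biInter (Finset.countable_toSet _) fun k _ => measurableSet_lt_tau x k)

/-! ### The walk killed at time `τ` and its potential operator -/

/-- The transition operator of the walk killed when it would step to `(-∞, 0]`. -/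
noncomputable def killed (ρ : Measure ℝ) (f : ℝ≥0 → ℝ≥0∞) (x : ℝ≥0) : ℝ≥0∞ :=
  ∫⁻ y in {y | 0 < (x : ℝ) + y}, f (step x y) ∂ρ

/-- The potential operator of the killed walk. -/
noncomputable def green (ρ : Measure ℝ) (f : ℝ≥0 → ℝ≥0∞) (x : ℝ≥0) : ℝ≥0∞ :=
  ∑' k : ℕ, (killed ρ)^[k] f x

theorem measurable_step_right (x : ℝ≥0) : Measurable (step x) :=
  measurable_step.comp measurable_prodMk_left

theorem measurableSet_alive (x : ℝ≥0) : MeasurableSet {y : ℝ | 0 < (x : ℝ) + y} :=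
  measurableSet_lt measurable_const (measurable_const.add measurable_id)

theorem killed_mono (ρ : Measure ℝ) {f g : ℝ≥0 → ℝ≥0∞} (h : f ≤ g) : killed ρ f ≤ killed ρ g :=
  fun _ => lintegral_mono fun _ => h _

theorem green_mono (ρ : Measure ℝ) {f g : ℝ≥0 → ℝ≥0∞} (h : f ≤ g) : green ρ f ≤ green ρ g := fun x =>
  ENNReal.tsum_le_tsum fun k =>
    Monotone.iterate (fun _ _ h => killed_mono ρ h) k h x

/-- The form `G = I + G K`, a mere reindexing of the series; it serves for the invariance of `μ`. -/
theorem green_eq_add_green_killed (ρ : Measure ℝ) (f : ℝ≥0 → ℝ≥0∞) (x : ℝ≥0) :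
    green ρ f x = f x + green ρ (killed ρ f) x := by
  rw [green, tsum_eq_zero_add' ENNReal.summable]
  rfl

theorem measurable_comp_walk {f : ℝ≥0 → ℝ≥0∞} (hf : Measurable f) (x : ℝ≥0) (k : ℕ) :
    Measurable fun y : ℕ → ℝ => f (walk x y k) :=
  hf.comp (measurable_walk x k)

theorem measurable_comp_step {f : ℝ≥0 → ℝ≥0∞} (hf : Measurable f) (x : ℝ≥0) :
    Measurable fun y : ℝ => f (step x y) :=
  hf.comp (measurable_step_right x)

section

variable (ρ : Measure ℝ) [IsProbabilityMeasure ρ] {f : ℝ≥0 → ℝ≥0∞}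

theorem measurable_killed (hf : Measurable f) : Measurable (killed ρ f) := by
  have h : killed ρ f = fun x => ∫⁻ y, ({p : ℝ≥0 × ℝ | 0 < (p.1 : ℝ) + p.2}.indicator
      (fun p => f (step p.1 p.2))) (x, y) ∂ρ := by
    funext x
    rw [killed, ← lintegral_indicator (measurableSet_alive x)]
    rfl
  rw [h]
  refine Measurable.lintegral_prod_right' (Measurable.indicator (hf.comp measurable_step) ?_)
  exact measurableSet_lt measurable_const
    (measurable_fst.coe_nnreal_real.add measurable_snd)

theorem measurable_iterate_killed (hf : Measurable f) (k : ℕ) :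
    Measurable ((killed ρ)^[k] f) := by
  induction k with
  | zero => exact hf
  | succ k ih =>
    rw [Function.iterate_succ_apply']
    exact measurable_killed ρ ih

theorem measurable_green (hf : Measurable f) : Measurable (green ρ f) :=
  Measurable.tsum fun k => measurable_iterate_killed ρ hf k

/-- The bridge from paths to operators. The induction conditions on the first increment, hence needs
every starting point. -/
theorem setLIntegral_walk (hf : Measurable f) (k : ℕ) (x : ℝ≥0) :
    ∫⁻ y in {y | (k : ℕ∞) < tau x y}, f (walk x y k) ∂(incrLaw ρ) = (killed ρ)^[k] f x := by
  induction k generalizing x with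
  | zero =>
    have h : {y : ℕ → ℝ | ((0 : ℕ) : ℕ∞) < tau x y} = Set.univ := by
      ext y
      simpa using (lt_tau_iff x y 0).2 (by simp)
    rw [h]
    simp [walk]
  | succ k ih =>
    have hm : Measurable ({y : ℕ → ℝ | ((k + 1 : ℕ) : ℕ∞) < tau x y}.indicator
        fun y => f (walk x y (k + 1))) :=
      (measurable_comp_walk hf x _).indicator (measurableSet_lt_tau x _)
    have hm' : Measurable fun p : ℝ × (ℕ → ℝ) =>
        {y : ℕ → ℝ | ((k + 1 : ℕ) : ℕ∞) < tau x y}.indicator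
          (fun y => f (walk x y (k + 1))) (prepend p.1 p.2) :=
      hm.comp measurable_prepend
    rw [Function.iterate_succ_apply', killed, ← lintegral_indicator (measurableSet_lt_tau x _),
      ← (measurePreserving_prepend ρ).lintegral_comp hm,
      lintegral_prod _ hm'.aemeasurable,
      ← lintegral_indicator (measurableSet_alive x)]
    refine lintegral_congr fun y => ?_
    by_cases hy : 0 < (x : ℝ) + y
    · rw [Set.indicator_of_mem (show y ∈ {y : ℝ | 0 < (x : ℝ) + y} from hy), ← ih,
        ← lintegral_indicator (measurableSet_lt_tau _ k)]
      refine lintegral_congr fun w => ?_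
      simp only [Set.indicator, Set.mem_ofPred_eq, lt_tau_prepend, walk_prepend, hy, true_and]
    · rw [Set.indicator_of_notMem (show y ∉ {y : ℝ | 0 < (x : ℝ) + y} from hy)]
      simp only [Set.indicator, Set.mem_ofPred_eq, lt_tau_prepend, hy, false_and, if_false,
        lintegral_zero]

theorem green_eq_tsum (hf : Measurable f) (x : ℝ≥0) :
    green ρ f x =
      ∑' k : ℕ, ∫⁻ y in {y | (k : ℕ∞) < tau x y}, f (walk x y k) ∂(incrLaw ρ) :=
  tsum_congr fun k => (setLIntegral_walk ρ hf k x).symm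

theorem green_eq_lintegral (hf : Measurable f) (x : ℝ≥0) :
    green ρ f x = ∫⁻ y, ∑' k : ℕ, {y | (k : ℕ∞) < tau x y}.indicator
      (fun y => f (walk x y k)) y ∂(incrLaw ρ) := by
  rw [lintegral_tsum fun k => ((measurable_comp_walk hf x k).indicator
    (measurableSet_lt_tau x k)).aemeasurable, green_eq_tsum ρ hf]
  exact tsum_congr fun k => (lintegral_indicator (measurableSet_lt_tau x k) _).symm

theorem green_add {g : ℝ≥0 → ℝ≥0∞} (hf : Measurable f) (hg : Measurable g) (x : ℝ≥0) :
    green ρ (fun z => f z + g z) x = green ρ f x + green ρ g x := by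
  rw [green_eq_tsum ρ (f := fun z => f z + g z) (hf.add hg), green_eq_tsum ρ hf, green_eq_tsum ρ hg, ← ENNReal.tsum_add]
  exact tsum_congr fun k => lintegral_add_left (measurable_comp_walk hf x k) _

theorem green_const_mul (c : ℝ≥0∞) (hf : Measurable f) (x : ℝ≥0) :
    green ρ (fun z => c * f z) x = c * green ρ f x := by
  rw [green_eq_tsum ρ (hf.const_mul c), green_eq_tsum ρ hf, ← ENNReal.tsum_mul_left]
  exact tsum_congr fun k => lintegral_const_mul c (measurable_comp_walk hf x k)

/-- The form `G = I + K G` exchanges sum and integral, hence the measurability of `f`; it serves for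
the Poisson equation. -/
theorem green_eq_add_killed_green (hf : Measurable f) (x : ℝ≥0) :
    green ρ f x = f x + killed ρ (green ρ f) x := by
  rw [green, tsum_eq_zero_add' ENNReal.summable]
  congr 1
  rw [killed]
  unfold green
  rw [lintegral_tsum fun k =>
    (measurable_comp_step (measurable_iterate_killed ρ hf k) x).aemeasurable]
  exact tsum_congr fun k => by rw [Function.iterate_succ_apply']; rfl

/-- Any supersolution of `V = f + killed V` dominates the potential of `f`. -/
theorem green_le_of_supersolution {V : ℝ≥0 → ℝ≥0∞} (hf : Measurable f)
    (hV : ∀ x, f x + killed ρ V x ≤ V x) (x : ℝ≥0) : green ρ f x ≤ V x := by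
  refine ENNReal.tsum_le_of_sum_range_le fun n => ?_
  induction n generalizing x with
  | zero => simp
  | succ n ih =>
    -- Partial sums satisfy `S_{n+1} = f + K S_n`, so `S_n ≤ V` gives `S_{n+1} ≤ f + K V ≤ V`.
    rw [Finset.sum_range_succ', add_comm]
    refine le_trans (add_le_add le_rfl ?_) (hV x)
    simp only [Function.iterate_succ_apply']
    rw [killed]
    simp only [killed.eq_1 ρ _ x]
    rw [← lintegral_finsetSum _ fun k _ =>
      measurable_comp_step (measurable_iterate_killed ρ hf k) x]
    exact lintegral_mono fun y => ih (step x y)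

end

end ReflectedWalk
namespace ReflectedWalk

/-! ### The drift condition -/

theorem real_add_rpow_le {p a b : ℝ} (hp : 1 ≤ p) (ha : 0 ≤ a) (hb : 0 ≤ b) :
    (a + b) ^ p ≤ 2 ^ (p - 1) * (a ^ p + b ^ p) := by
  lift a to ℝ≥0 using ha
  lift b to ℝ≥0 using hb
  exact_mod_cast NNReal.rpow_add_le_mul_rpow_add_rpow a b hp

section

variable (ρ : Measure ℝ) [IsProbabilityMeasure ρ] {s : ℝ}

/-- Bernoulli's inequality for `w ≥ -1`; below `-1` the affine side is nonpositive because `s ≥ 1`.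
-/
theorem max_one_add_rpow_lower (hs : 1 ≤ s) (w : ℝ) : 1 + s * w ≤ (max (1 + w) 0) ^ s := by
  rcases le_total (-1) w with h | h
  · rw [max_eq_left (by linarith)]
    exact one_add_mul_self_le_rpow_one_add h hs
  · rw [max_eq_right (by linarith), Real.zero_rpow (by linarith)]
    nlinarith

/-- Convexity of the power between `1` and `max (1 + w) 0`. With `t = z⁻¹` it bounds the scaled
increment from above uniformly in `z ≥ 1`, as dominated convergence requires. -/
theorem max_one_add_rpow_upper (hs : 1 ≤ s) {t : ℝ} (ht0 : 0 ≤ t) (ht1 : t ≤ 1) (w : ℝ) :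
    (max (1 + t * w) 0) ^ s ≤ 1 + t * ((max (1 + w) 0) ^ s - 1) := by
  have hconv := (convexOn_rpow hs).2 (Set.mem_Ici.2 (zero_le_one' ℝ))
    (Set.mem_Ici.2 (le_max_right (1 + w) 0)) (sub_nonneg.2 ht1) ht0 (sub_add_cancel 1 t)
  simp only [smul_eq_mul, mul_one, Real.one_rpow] at hconv
  refine le_trans (Real.rpow_le_rpow (le_max_right _ _) ?_ (by linarith))
    (hconv.trans (le_of_eq (by ring)))
  refine max_le ?_ (by have := mul_nonneg ht0 (le_max_right (1 + w) 0); linarith)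
  have := mul_le_mul_of_nonneg_left (le_max_left (1 + w) 0) ht0
  linarith

theorem integrable_id_of_rpow (hs : 1 ≤ s) (h : Integrable (fun y : ℝ => |y| ^ s) ρ) :
    Integrable (fun y : ℝ => y) ρ := by
  refine Integrable.mono' ((integrable_const (1 : ℝ)).add h) measurable_id.aestronglyMeasurable
    (Filter.Eventually.of_forall fun y => ?_)
  simp only [Real.norm_eq_abs, Pi.add_apply]
  rcases le_total |y| 1 with hy | hy
  · have := Real.rpow_nonneg (abs_nonneg y) s
    linarith
  · have := Real.rpow_le_rpow_of_exponent_le hy hs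
    rw [Real.rpow_one] at this
    linarith

theorem integrable_max_add_rpow (hs : 1 ≤ s) (h : Integrable (fun y : ℝ => |y| ^ s) ρ)
    {z : ℝ} (hz : 0 ≤ z) : Integrable (fun y : ℝ => (max (z + y) 0) ^ s) ρ := by
  refine Integrable.mono' (((integrable_const (z ^ s)).add h).const_mul ((2 : ℝ) ^ (s - 1)))
    (Measurable.aestronglyMeasurable (by fun_prop)) (Filter.Eventually.of_forall fun y => ?_)
  rw [Real.norm_eq_abs, abs_of_nonneg (Real.rpow_nonneg (le_max_right _ _) _)]
  refine le_trans (Real.rpow_le_rpow (le_max_right _ _)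
    (max_le (by linarith [le_abs_self y]) (by positivity) : max (z + y) 0 ≤ z + |y|)
    (by linarith)) ?_
  exact real_add_rpow_le hs hz (abs_nonneg y)

/-- This is the derivative of `(1 + t w)^s` at `t = 0`, read along `t = z⁻¹`; the truncation is
inactive for large `z`. -/
theorem tendsto_scaled_increment (s w : ℝ) :
    Filter.Tendsto (fun z : ℝ => z * ((max (1 + z⁻¹ * w) 0) ^ s - 1)) Filter.atTop
      (nhds (s * w)) := by
  have hd : HasDerivAt (fun t : ℝ => (1 + t * w) ^ s) (s * w) 0 := by
    have h1 : HasDerivAt (fun t : ℝ => 1 + t * w) w 0 := by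
      simpa using ((hasDerivAt_id (0 : ℝ)).mul_const w).const_add 1
    have h2 := h1.rpow_const (p := s) (Or.inl (by norm_num))
    simpa [mul_comm] using h2
  have h3 := hd.tendsto_slope_zero_right
  have h4 := h3.comp tendsto_inv_atTop_nhdsGT_zero
  refine h4.congr' ?_
  have h5 : Filter.Tendsto (fun z : ℝ => 1 + z⁻¹ * w) Filter.atTop (nhds (1 + 0 * w)) :=
    (tendsto_inv_atTop_zero.mul_const w).const_add 1
  filter_upwards [h5.eventually (lt_mem_nhds (by norm_num : (0 : ℝ) < 1 + 0 * w))] with z hz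
  simp only [Function.comp_apply, zero_add, inv_inv, smul_eq_mul, zero_mul, add_zero,
    Real.one_rpow, max_eq_left hz.le]

/-- By homogeneity, the mean increment of `z^s` is `z^(s-1)` times the mean of `z ((1 + Y/z)₊^s -
1)`, which tends to `s E Y < 0` by dominated convergence. -/
theorem exists_drift (hs : 1 ≤ s) (h : Integrable (fun y : ℝ => |y| ^ s) ρ)
    (hdrift : ∫ y, y ∂ρ < 0) :
    ∃ c > 0, ∃ a : ℝ, 1 ≤ a ∧ ∀ z, a ≤ z →
      c * z ^ (s - 1) + ∫ y, (max (z + y) 0) ^ s ∂ρ ≤ z ^ s := by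
  have hid := integrable_id_of_rpow ρ hs h
  have hmax := integrable_max_add_rpow ρ hs h zero_le_one
  have hlim : Filter.Tendsto
      (fun z : ℝ => ∫ y, z * ((max (1 + z⁻¹ * y) 0) ^ s - 1) ∂ρ) Filter.atTop
      (nhds (∫ y, s * y ∂ρ)) := by
    refine tendsto_integral_filter_of_dominated_convergence
      (fun y => s * |y| + |(max (1 + y) 0) ^ s - 1|)
      (Filter.Eventually.of_forall fun z => Measurable.aestronglyMeasurable (by fun_prop)) ?_
      ((hid.abs.const_mul s).add (hmax.sub (integrable_const 1)).abs)
      (Filter.Eventually.of_forall fun y => tendsto_scaled_increment s y)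
    filter_upwards [Filter.eventually_ge_atTop (1 : ℝ)] with z hz
    refine Filter.Eventually.of_forall fun y => ?_
    have hz0 : 0 < z := by linarith
    have hlow := mul_le_mul_of_nonneg_left (max_one_add_rpow_lower hs (z⁻¹ * y)) hz0.le
    have hupp := mul_le_mul_of_nonneg_left
      (max_one_add_rpow_upper hs (inv_nonneg.2 hz0.le) (inv_le_one_of_one_le₀ hz) y) hz0.le
    have e1 : z * (1 + s * (z⁻¹ * y)) = z + s * y := by field_simp
    have e2 : z * (1 + z⁻¹ * ((max (1 + y) 0) ^ s - 1)) = z + ((max (1 + y) 0) ^ s - 1) := by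
      field_simp
    rw [e1] at hlow
    rw [e2] at hupp
    have h1 := abs_nonneg ((max (1 + y) 0) ^ s - 1)
    have h2 := le_abs_self ((max (1 + y) 0) ^ s - 1)
    have h3 := mul_le_mul_of_nonneg_left (neg_abs_le y) (by linarith : 0 ≤ s)
    have h4 : 0 ≤ s * |y| := mul_nonneg (by linarith) (abs_nonneg y)
    rw [Real.norm_eq_abs, abs_le]
    constructor <;> linarith
  have hneg : ∫ y, s * y ∂ρ < 0 := by
    rw [integral_const_mul]
    exact mul_neg_of_pos_of_neg (by linarith) hdrift
  obtain ⟨c, hc, hc'⟩ : ∃ c > 0, ∫ y, s * y ∂ρ < -c :=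
    ⟨-(∫ y, s * y ∂ρ) / 2, by linarith, by linarith⟩
  obtain ⟨a, ha⟩ := Filter.eventually_atTop.1 (hlim.eventually (gt_mem_nhds hc'))
  refine ⟨c, hc, max a 1, le_max_right _ _, fun z hz => ?_⟩
  have hz0 : 0 < z := lt_of_lt_of_le (by norm_num) ((le_max_right a 1).trans hz)
  have hscale : ∀ y : ℝ, (max (z + y) 0) ^ s =
      z ^ s + z ^ (s - 1) * (z * ((max (1 + z⁻¹ * y) 0) ^ s - 1)) := by
    intro y
    have e1 : max (z + y) 0 = z * max (1 + z⁻¹ * y) 0 := by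
      rw [mul_max_of_nonneg _ _ hz0.le, mul_zero]
      congr 1
      field_simp
    rw [e1, Real.mul_rpow hz0.le (le_max_right _ _), ← mul_assoc,
      ← Real.rpow_add_one hz0.ne', sub_add_cancel]
    ring
  have hint : Integrable (fun y => z ^ (s - 1) * (z * ((max (1 + z⁻¹ * y) 0) ^ s - 1))) ρ := by
    refine ((integrable_max_add_rpow ρ hs h hz0.le).sub (integrable_const (z ^ s))).congr
      (Filter.Eventually.of_forall fun y => ?_)
    simp only [Pi.sub_apply, hscale]
    ring
  have hval : ∫ y, (max (z + y) 0) ^ s ∂ρ =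
      z ^ s + z ^ (s - 1) * ∫ y, z * ((max (1 + z⁻¹ * y) 0) ^ s - 1) ∂ρ := by
    simp_rw [hscale]
    rw [integral_add (integrable_const _) hint, integral_const_mul]
    simp
  rw [hval]
  have := mul_le_mul_of_nonneg_left (ha z ((le_max_left a 1).trans hz)).le
    (Real.rpow_nonneg hz0.le (s - 1))
  linarith

theorem one_le_u (t : ℝ) (x : ℝ≥0) : 1 ≤ u t x := by
  have := Real.rpow_nonneg x.coe_nonneg t
  unfold u
  linarith

theorem measurable_u (t : ℝ) : Measurable (u t) := by
  unfold u
  fun_prop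

/-- The potential of the weight of exponent `s - 1` is controlled by the weight of
exponent `s`. -/
theorem exists_green_le (hs : 1 ≤ s) (h : Integrable (fun y : ℝ => |y| ^ s) ρ)
    (hdrift : ∫ y, y ∂ρ < 0) :
    ∃ C : ℝ, 0 ≤ C ∧ ∀ x : ℝ≥0,
      green ρ (fun z => ENNReal.ofReal (u (s - 1) z)) x ≤ ENNReal.ofReal (C * u s x) := by
  obtain ⟨c, hc, a, ha, hca⟩ := exists_drift ρ hs h hdrift
  have hs0 : 0 ≤ s := by linarith
  have hs1 : 0 ≤ s - 1 := by linarith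
  -- The shift by `a` puts every `x + a` in the drift region. The factor `2 / c` turns the gain `c
  -- (x+a)^(s-1)` into `2 (x+a)^(s-1)`, which dominates `1 + x^(s-1)` as `a ≥ 1`.
  have hsuper : ∀ x : ℝ≥0, ENNReal.ofReal (u (s - 1) x) +
      killed ρ (fun z => ENNReal.ofReal (2 / c * ((z : ℝ) + a) ^ s)) x ≤
        ENNReal.ofReal (2 / c * ((x : ℝ) + a) ^ s) := by
    intro x
    have hxa : a ≤ (x : ℝ) + a := by linarith [x.coe_nonneg]
    have hint := (integrable_max_add_rpow ρ hs h
      (by linarith : 0 ≤ (x : ℝ) + a)).const_mul (2 / c)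
    have hk : killed ρ (fun z => ENNReal.ofReal (2 / c * ((z : ℝ) + a) ^ s)) x ≤
        ENNReal.ofReal (2 / c * ∫ y, (max ((x : ℝ) + a + y) 0) ^ s ∂ρ) := by
      rw [← integral_const_mul, ofReal_integral_eq_lintegral_ofReal hint
        (Filter.Eventually.of_forall fun y =>
          mul_nonneg (by positivity) (Real.rpow_nonneg (le_max_right _ _) _))]
      -- On surviving steps the shift commutes with the step; adding the other increments only
      -- enlarges the integral.
      refine le_trans (setLIntegral_mono' (measurableSet_alive x) fun y hy => ?_)
        (setLIntegral_le_lintegral _ _)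
      have hy' : 0 < (x : ℝ) + y := hy
      simp only [coe_step]
      rw [max_eq_left hy'.le, max_eq_left (by linarith)]
      exact le_of_eq (by congr 3; ring)
    refine (add_le_add le_rfl hk).trans ?_
    rw [← ENNReal.ofReal_add (by linarith [one_le_u (s - 1) x])
      (mul_nonneg (by positivity)
        (integral_nonneg fun y => Real.rpow_nonneg (le_max_right _ _) _))]
    refine ENNReal.ofReal_le_ofReal ?_
    have hu : u (s - 1) x ≤ 2 * ((x : ℝ) + a) ^ (s - 1) := by
      have h1 := Real.one_le_rpow (ha.trans hxa) hs1
      have h2 := Real.rpow_le_rpow x.coe_nonneg (by linarith : (x : ℝ) ≤ x + a) hs1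
      unfold u
      linarith
    have hd := mul_le_mul_of_nonneg_left (hca _ hxa) (by positivity : 0 ≤ 2 / c)
    have e : 2 / c * (c * ((x : ℝ) + a) ^ (s - 1) + ∫ y, (max ((x : ℝ) + a + y) 0) ^ s ∂ρ) =
        2 * ((x : ℝ) + a) ^ (s - 1) +
          2 / c * ∫ y, (max ((x : ℝ) + a + y) 0) ^ s ∂ρ := by
      field_simp
    rw [e] at hd
    linarith
  refine ⟨2 / c * (2 ^ (s - 1) * a ^ s), by positivity, fun x => ?_⟩
  refine (green_le_of_supersolution ρ (measurable_u _).ennreal_ofReal hsuper x).trans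
    (ENNReal.ofReal_le_ofReal ?_)
  rw [mul_assoc]
  refine mul_le_mul_of_nonneg_left ?_ (by positivity)
  refine (real_add_rpow_le hs x.coe_nonneg (by linarith)).trans ?_
  rw [mul_assoc]
  refine mul_le_mul_of_nonneg_left ?_ (by positivity)
  have h1 := Real.one_le_rpow ha hs0
  have h2 := Real.rpow_nonneg x.coe_nonneg s
  unfold u
  nlinarith

end

end ReflectedWalk
namespace ReflectedWalk

/-! ### Excursions, the operator `R` and the measure `μ` in terms of the potential operator -/

/-- Finiteness matters: `toNat` sends `⊤` to `0`, which would empty the right-hand sum. -/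
theorem tsum_indicator_lt_tau {x : ℝ≥0} {y : ℕ → ℝ} (h : tau x y < ⊤)
    (F : ℕ → (ℕ → ℝ) → ℝ≥0∞) :
    ∑' k : ℕ, {y | (k : ℕ∞) < tau x y}.indicator (F k) y =
      ∑ k ∈ Finset.range (tau x y).toNat, F k y := by
  obtain ⟨n, hn⟩ := ENat.ne_top_iff_exists.1 h.ne
  rw [← hn, ENat.toNat_natCast, tsum_eq_sum (s := Finset.range n)]
  · refine Finset.sum_congr rfl fun k hk => Set.indicator_of_mem ?_ _
    rw [Set.mem_ofPred_eq, ← hn]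
    exact_mod_cast Finset.mem_range.1 hk
  · intro k hk
    refine Set.indicator_of_notMem ?_ _
    rw [Set.mem_ofPred_eq, ← hn]
    rw [Finset.mem_range] at hk
    exact_mod_cast hk

theorem coe_tau_eq_tsum (x : ℝ≥0) (y : ℕ → ℝ) :
    (tau x y : ℝ≥0∞) = ∑' k : ℕ, {y | (k : ℕ∞) < tau x y}.indicator (fun _ => 1) y := by
  rcases eq_or_lt_of_le (le_top : tau x y ≤ ⊤) with h | h
  · have h1 : ∀ k : ℕ, {y | (k : ℕ∞) < tau x y}.indicator (fun _ => (1 : ℝ≥0∞)) y = 1 := by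
      intro k
      refine Set.indicator_of_mem ?_ _
      rw [Set.mem_ofPred_eq, h]
      exact ENat.natCast_lt_top k
    simp only [h1, h, ENat.toENNReal_top]
    exact (ENNReal.tsum_const_eq_top_of_ne_zero one_ne_zero).symm
  · rw [tsum_indicator_lt_tau h]
    obtain ⟨n, hn⟩ := ENat.ne_top_iff_exists.1 h.ne
    simp [← hn]

theorem measurable_excursionSum {f : ℝ≥0 → ℝ} (hf : Measurable f) (x : ℝ≥0) :
    Measurable (excursionSum f x) := by
  have h1 : Measurable fun p : ℕ × (ℕ → ℝ) => ∑ k ∈ Finset.range p.1, f (walk x p.2 k) :=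
    measurable_from_prod_countable_right fun n => show Measurable fun y : ℕ → ℝ =>
        ∑ k ∈ Finset.range n, f (walk x y k) from
      Finset.measurable_fun_sum _ fun k _ => hf.comp (measurable_walk x k)
  have h2 : Measurable fun y : ℕ → ℝ => ((tau x y).toNat, y) :=
    ((measurable_of_countable ENat.toNat).comp (measurable_tau x)).prodMk measurable_id
  exact h1.comp h2

theorem excursionSum_nonneg {f : ℝ≥0 → ℝ} (hf0 : ∀ z, 0 ≤ f z) (x : ℝ≥0) (y : ℕ → ℝ) :
    0 ≤ excursionSum f x y :=
  Finset.sum_nonneg fun _ _ => hf0 _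

theorem green_ofReal_ne_top_of_abs (ρ : Measure ℝ) {h f : ℝ≥0 → ℝ} {x : ℝ≥0} (hfh : ∀ z, f z ≤ |h z|)
    (hhx : green ρ (fun z => ENNReal.ofReal |h z|) x ≠ ⊤) :
    green ρ (fun z => ENNReal.ofReal (f z)) x ≠ ⊤ :=
  ne_top_of_le_ne_top hhx
    (green_mono ρ (fun z => ENNReal.ofReal_le_ofReal (hfh z)) x)

theorem one_le_green_one (ρ : Measure ℝ) (x : ℝ≥0) : 1 ≤ green ρ (fun _ => 1) x := by
  rw [green_eq_add_green_killed]
  exact le_self_add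

theorem abs_le_mul_of_mem_weightedSpace {f v : ℝ≥0 → ℝ} (hv : ∀ x, 0 < v x)
    (hf : f ∈ weightedSpace 1 v) : ∃ C : ℝ, 0 ≤ C ∧ ∀ x, |f x| ≤ C * v x := by
  obtain ⟨C, hC⟩ := hf.2
  refine ⟨max C 0, le_max_right _ _, fun x => ?_⟩
  have h1 : |f x| ^ (1 : ℝ) / v x ≤ C := hC ⟨x, rfl⟩
  rw [Real.rpow_one] at h1
  exact (div_le_iff₀ (hv x)).1 (h1.trans (le_max_left _ _))

section

variable (ρ : Measure ℝ) [IsProbabilityMeasure ρ]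

theorem lintegral_tau (x : ℝ≥0) :
    ∫⁻ y, (tau x y : ℝ≥0∞) ∂(incrLaw ρ) = green ρ (fun _ => 1) x := by
  rw [green_eq_lintegral ρ measurable_const]
  exact lintegral_congr fun y => coe_tau_eq_tsum x y

theorem ae_tau_lt_top {x : ℝ≥0} (hx : green ρ (fun _ => 1) x ≠ ⊤) :
    ∀ᵐ y ∂(incrLaw ρ), tau x y < ⊤ := by
  rw [← lintegral_tau] at hx
  have hm : Measurable fun y => (tau x y : ℝ≥0∞) :=
    (measurable_of_countable ENat.toENNReal).comp (measurable_tau x)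
  filter_upwards [ae_lt_top hm hx] with y hy
  exact ENat.toENNReal_lt_top.1 hy

theorem lintegral_excursionSum {f : ℝ≥0 → ℝ} (hf : Measurable f) (hf0 : ∀ z, 0 ≤ f z) {x : ℝ≥0}
    (hx : green ρ (fun _ => 1) x ≠ ⊤) :
    ∫⁻ y in {y | tau x y < ⊤}, ENNReal.ofReal (excursionSum f x y) ∂(incrLaw ρ) =
      green ρ (fun z => ENNReal.ofReal (f z)) x := by
  have hae : ∀ᵐ y ∂(incrLaw ρ), y ∈ {y | tau x y < ⊤} := ae_tau_lt_top ρ hx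
  -- As `τ` has finite mean, restricting to `τ < ⊤` discards only a null set.
  rw [Measure.restrict_eq_self_of_ae_mem hae, green_eq_lintegral ρ hf.ennreal_ofReal]
  refine lintegral_congr_ae ?_
  filter_upwards [hae] with y hy
  rw [tsum_indicator_lt_tau hy, excursionSum, ENNReal.ofReal_sum_of_nonneg fun k _ => hf0 _]

theorem integrableOn_excursionSum {f : ℝ≥0 → ℝ} (hf : Measurable f) (hf0 : ∀ z, 0 ≤ f z)
    {x : ℝ≥0} (hx : green ρ (fun _ => 1) x ≠ ⊤)
    (hfx : green ρ (fun z => ENNReal.ofReal (f z)) x ≠ ⊤) :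
    IntegrableOn (excursionSum f x) {y | tau x y < ⊤} (incrLaw ρ) := by
  refine ⟨(measurable_excursionSum hf x).aestronglyMeasurable, ?_⟩
  rw [hasFiniteIntegral_iff_ofReal
    (Filter.Eventually.of_forall (excursionSum_nonneg hf0 x)),
    lintegral_excursionSum ρ hf hf0 hx]
  exact hfx.lt_top

theorem integral_excursionSum {f : ℝ≥0 → ℝ} (hf : Measurable f) (hf0 : ∀ z, 0 ≤ f z)
    {x : ℝ≥0} (hx : green ρ (fun _ => 1) x ≠ ⊤) :
    ∫ y in {y | tau x y < ⊤}, excursionSum f x y ∂(incrLaw ρ) =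
      (green ρ (fun z => ENNReal.ofReal (f z)) x).toReal := by
  rw [integral_eq_lintegral_of_nonneg_ae
    (Filter.Eventually.of_forall (excursionSum_nonneg hf0 x))
    (measurable_excursionSum hf x).aestronglyMeasurable, lintegral_excursionSum ρ hf hf0 hx]

/-- `ENNReal.ofReal` truncates at `0`, so the two potentials are those of the positive and negative
parts; finiteness for `|h|` excludes `∞ - ∞`. -/
theorem R_eq_sub {h : ℝ≥0 → ℝ} (hh : Measurable h) {x : ℝ≥0}
    (hx : green ρ (fun _ => 1) x ≠ ⊤)
    (hhx : green ρ (fun z => ENNReal.ofReal |h z|) x ≠ ⊤) :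
    R ρ h x = (green ρ (fun z => ENNReal.ofReal (h z)) x).toReal -
      (green ρ (fun z => ENNReal.ofReal (-h z)) x).toReal := by
  have hpm : Measurable fun z => max (h z) 0 := hh.max measurable_const
  have hnm : Measurable fun z => max (-h z) 0 := hh.neg.max measurable_const
  have hp0 : ∀ z, 0 ≤ max (h z) 0 := fun z => le_max_right _ _
  have hn0 : ∀ z, 0 ≤ max (-h z) 0 := fun z => le_max_right _ _
  have hsplit : ∀ y, excursionSum h x y =
      excursionSum (fun z => max (h z) 0) x y - excursionSum (fun z => max (-h z) 0) x y := by
    intro y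
    unfold excursionSum
    rw [← Finset.sum_sub_distrib]
    refine Finset.sum_congr rfl fun k _ => ?_
    beta_reduce
    rcases le_total (h (walk x y k)) 0 with h0 | h0
    · rw [max_eq_right h0, max_eq_left (by linarith)]
      ring
    · rw [max_eq_left h0, max_eq_right (by linarith)]
      ring
  have hp := integrableOn_excursionSum ρ hpm hp0 hx (green_ofReal_ne_top_of_abs ρ
    (fun z => max_le (le_abs_self _) (abs_nonneg _)) hhx)
  have hn := integrableOn_excursionSum ρ hnm hn0 hx (green_ofReal_ne_top_of_abs ρ
    (fun z => max_le (neg_le_abs _) (abs_nonneg _)) hhx)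
  have e : ∀ r : ℝ, ENNReal.ofReal (max r 0) = ENNReal.ofReal r := by
    intro r
    simp [ENNReal.ofReal_max]
  rw [R]
  simp_rw [hsplit]
  rw [integral_sub hp hn, integral_excursionSum ρ hpm hp0 hx, integral_excursionSum ρ hnm hn0 hx]
  simp only [e]

/-! ### The measure `μ` as the normalised potential at `0`, and its invariance. -/

theorem lintegral_mu {f : ℝ≥0 → ℝ≥0∞} (hf : Measurable f) :
    ∫⁻ z, f z ∂(mu ρ) = (green ρ (fun _ => 1) 0)⁻¹ * green ρ f 0 := by
  rw [mu, lintegral_smul_measure, lintegral_sum_measure, lintegral_tau, green_eq_tsum ρ hf,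
    smul_eq_mul]
  congr 1
  exact tsum_congr fun k => lintegral_map hf (measurable_walk 0 k)

theorem isProbabilityMeasure_mu (h0 : green ρ (fun _ => 1) 0 ≠ ⊤) :
    IsProbabilityMeasure (mu ρ) := by
  refine ⟨?_⟩
  rw [← lintegral_one, lintegral_mu ρ measurable_const]
  exact ENNReal.inv_mul_cancel (zero_lt_one.trans_le (one_le_green_one ρ 0)).ne' h0

/-- An increment that kills the walk sends the reflected walk exactly to `0`. -/
theorem lintegral_kernel {f : ℝ≥0 → ℝ≥0∞} (hf : Measurable f) (x : ℝ≥0) :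
    ∫⁻ z, f z ∂(kernel ρ x) = killed ρ f x + f 0 * kernel ρ x {0} := by
  have hk : kernel ρ x = ρ.map (step x) := rfl
  have hset : step x ⁻¹' {0} = {y | 0 < (x : ℝ) + y}ᶜ := by
    ext y
    simp [step]
  rw [hk, lintegral_map hf (measurable_step_right x),
    Measure.map_apply (measurable_step_right x) (measurableSet_singleton 0), hset,
    ← lintegral_add_compl _ (measurableSet_alive x), killed]
  congr 1
  rw [← setLIntegral_const]
  refine setLIntegral_congr_fun (measurableSet_alive x).compl fun y hy => ?_
  rw [← hset] at hy
  simp only [show step x y = 0 from hy]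

instance (x : ℝ≥0) : IsProbabilityMeasure (kernel ρ x) :=
  Measure.isProbabilityMeasure_map (measurable_step_right x).aemeasurable

/-- The excursion ends almost surely, by a jump to `0`. -/
theorem green_kernel_zero {x : ℝ≥0} (hx : green ρ (fun _ => 1) x ≠ ⊤) :
    green ρ (fun z => kernel ρ z {0}) x = 1 := by
  have hp : Measurable fun z => kernel ρ z {0} :=
    Kernel.measurable_coe _ (measurableSet_singleton 0)
  have hsum : (fun z => killed ρ (fun _ => 1) z + kernel ρ z {0}) = fun _ => 1 := by
    funext z
    have h := lintegral_kernel ρ (f := fun _ => 1) measurable_const z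
    rw [lintegral_one, measure_univ, one_mul] at h
    exact h.symm
  have h1 := green_add ρ (measurable_killed ρ (measurable_const (a := (1 : ℝ≥0∞)))) hp x
  have h2 := green_eq_add_green_killed ρ (fun _ => 1) x
  rw [hsum, h2, add_comm] at h1
  -- From `G 1 = 1 + G K 1` and `G 1 = G K 1 + G p`, cancel `G K 1`, which is finite because `G 1`
  -- is.
  refine ((ENNReal.add_right_inj ?_).1 h1).symm
  rw [h2] at hx
  exact (ENNReal.add_ne_top.1 hx).2

/-- Up to the normalisation, `μ P (A) = G K 1_A (0) + 1_A(0) G p (0)`. As `G p (0) = 1`, this is `G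
1_A (0)`: the return to `0` replaces the starting point of the excursion. -/
theorem invariant_mu (h0 : green ρ (fun _ => 1) 0 ≠ ⊤) :
    Kernel.Invariant (kernel ρ) (mu ρ) := by
  refine Measure.ext fun A hA => ?_
  have hp : Measurable fun z => kernel ρ z {0} :=
    Kernel.measurable_coe _ (measurableSet_singleton 0)
  have hm : Measurable (A.indicator (1 : ℝ≥0 → ℝ≥0∞)) := measurable_one.indicator hA
  have hker : (fun z => kernel ρ z A) =
      fun z => killed ρ (A.indicator 1) z + A.indicator 1 0 * kernel ρ z {0} := by
    funext z
    rw [← lintegral_kernel ρ hm, lintegral_indicator_one hA]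
  rw [Measure.bind_apply hA (Kernel.measurable _).aemeasurable,
    lintegral_mu ρ (Kernel.measurable_coe _ hA), hker,
    green_add ρ (measurable_killed ρ hm) (hp.const_mul _), green_const_mul ρ _ hp,
    green_kernel_zero ρ h0, mul_one, add_comm, ← green_eq_add_green_killed, ← lintegral_mu ρ hm,
    lintegral_indicator_one hA]

/-- The Poisson equation with its defect at `0`, in additive form to avoid truncated subtraction. -/
theorem lintegral_kernel_green {f : ℝ≥0 → ℝ≥0∞} (hf : Measurable f) (x : ℝ≥0) :
    f x + ∫⁻ z, green ρ f z ∂(kernel ρ x) = green ρ f x + green ρ f 0 * kernel ρ x {0} := by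
  rw [lintegral_kernel ρ (measurable_green ρ hf), ← add_assoc, ← green_eq_add_killed_green ρ hf]

/-! ### The Poisson equation -/

/-- If `f` is nonnegative with finite potential, the real valued potential `G f` is integrable
against the kernel, and `P (G f) = G f - f + (G f) 0 * p` with `p` the probability of stepping
to `0`. -/
theorem integral_kernel_green {f : ℝ≥0 → ℝ≥0∞} (hf : Measurable f)
    (hfin : ∀ x, green ρ f x ≠ ⊤) (x : ℝ≥0) :
    Integrable (fun z => (green ρ f z).toReal) (kernel ρ x) ∧
      ∫ z, (green ρ f z).toReal ∂(kernel ρ x) =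
        (green ρ f x).toReal - (f x).toReal +
          (green ρ f 0).toReal * (kernel ρ x {0}).toReal := by
  have heq := lintegral_kernel_green ρ hf x
  have hr : green ρ f 0 * kernel ρ x {0} ≠ ⊤ := ENNReal.mul_ne_top (hfin 0) (measure_ne_top _ _)
  have htop : f x + ∫⁻ z, green ρ f z ∂(kernel ρ x) ≠ ⊤ := by
    rw [heq]
    exact ENNReal.add_ne_top.2 ⟨hfin x, hr⟩
  obtain ⟨h1, h2⟩ := ENNReal.add_ne_top.1 htop
  refine ⟨integrable_toReal_of_lintegral_ne_top (measurable_green ρ hf).aemeasurable h2, ?_⟩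
  rw [integral_toReal (measurable_green ρ hf).aemeasurable
    (Filter.Eventually.of_forall fun z => (hfin z).lt_top)]
  have h3 := congrArg ENNReal.toReal heq
  rw [ENNReal.toReal_add h1 h2, ENNReal.toReal_add (hfin x) hr, ENNReal.toReal_mul] at h3
  linarith

/-- The Poisson equation for `h` centered with respect to `μ`. -/
theorem poisson_of_integral_eq_zero {h : ℝ≥0 → ℝ} (hh : Measurable h)
    (h1 : ∀ x, green ρ (fun _ => 1) x ≠ ⊤)
    (hfin : ∀ x, green ρ (fun z => ENNReal.ofReal |h z|) x ≠ ⊤)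
    (hint : Integrable h (mu ρ)) (hzero : ∫ z, h z ∂(mu ρ) = 0) (x : ℝ≥0) :
    Integrable (R ρ h) (kernel ρ x) ∧ h x = R ρ h x - P ρ (R ρ h) x := by
  have hR : R ρ h = fun z => (green ρ (fun z => ENNReal.ofReal (h z)) z).toReal -
      (green ρ (fun z => ENNReal.ofReal (-h z)) z).toReal :=
    funext fun z => R_eq_sub ρ hh (h1 z) (hfin z)
  have hA : ∀ x, green ρ (fun z => ENNReal.ofReal (h z)) x ≠ ⊤ := fun x =>
    green_ofReal_ne_top_of_abs ρ (fun z => le_abs_self _) (hfin x)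
  have hB : ∀ x, green ρ (fun z => ENNReal.ofReal (-h z)) x ≠ ⊤ := fun x =>
    green_ofReal_ne_top_of_abs ρ (fun z => neg_le_abs _) (hfin x)
  -- Centring says that both parts of `h` have the same potential at `0`, so their defects cancel.
  have hAB : (green ρ (fun z => ENNReal.ofReal (h z)) 0).toReal =
      (green ρ (fun z => ENNReal.ofReal (-h z)) 0).toReal := by
    have hm := hh.neg.ennreal_ofReal
    simp only [Pi.neg_apply] at hm
    rw [integral_eq_lintegral_pos_part_sub_lintegral_neg_part hint,
      lintegral_mu ρ hh.ennreal_ofReal, lintegral_mu ρ hm, ENNReal.toReal_mul,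
      ENNReal.toReal_mul, ← mul_sub] at hzero
    have hpos : 0 < (green ρ (fun _ => 1) 0)⁻¹.toReal :=
      ENNReal.toReal_pos (ENNReal.inv_ne_zero.2 (h1 0))
        (ENNReal.inv_ne_top.2 (zero_lt_one.trans_le (one_le_green_one ρ 0)).ne')
    have := (mul_eq_zero.1 hzero).resolve_left hpos.ne'
    linarith
  obtain ⟨iA, eA⟩ := integral_kernel_green ρ hh.ennreal_ofReal hA x
  obtain ⟨iB, eB⟩ := integral_kernel_green ρ hh.neg.ennreal_ofReal hB x
  simp only [Pi.neg_apply] at iB eB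
  rw [hR, P]
  refine ⟨iA.sub iB, ?_⟩
  rw [integral_sub iA iB, eA, eB, hAB]
  have e : (ENNReal.ofReal (h x)).toReal - (ENNReal.ofReal (-h x)).toReal = h x := by
    rw [ENNReal.toReal_ofReal', ENNReal.toReal_ofReal', max_comm, max_comm (-h x)]
    rcases le_total (h x) 0 with h0 | h0
    · rw [max_eq_left h0, max_eq_right (by linarith)]
      ring
    · rw [max_eq_right h0, max_eq_left (by linarith)]
      ring
  linarith

end

end ReflectedWalk

/-! ### Proof of the main theorem. -/

open ReflectedWalk in
theorem mainTheorem5 (ρ : Measure ℝ) [IsProbabilityMeasure ρ] (s : ℝ) (hs : 1 ≤ s)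
    (hmoment : Integrable (fun y : ℝ => |y| ^ s) ρ) (hdrift : ∫ y, y ∂ρ < 0) :
    IsProbabilityMeasure (ReflectedWalk.mu ρ) ∧
    Kernel.Invariant (ReflectedWalk.kernel ρ) (ReflectedWalk.mu ρ) ∧
    ∀ f ∈ ReflectedWalk.weightedSpace 1 (ReflectedWalk.u (s - 1)),
      Integrable f (ReflectedWalk.mu ρ) ∧
      ReflectedWalk.RDefined ρ (fun x => f x - ∫ z, f z ∂(ReflectedWalk.mu ρ)) ∧
      ∃ g ∈ ReflectedWalk.weightedSpace 1 (ReflectedWalk.u s),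
        g = ReflectedWalk.R ρ (fun x => f x - ∫ z, f z ∂(ReflectedWalk.mu ρ)) ∧
        (∀ x : ℝ≥0, Integrable g (ReflectedWalk.kernel ρ x)) ∧
        ∀ x : ℝ≥0, f x = g x - ReflectedWalk.P ρ g x + ∫ z, f z ∂(ReflectedWalk.mu ρ) := by
  obtain ⟨C, hC0, hC⟩ := exists_green_le ρ hs hmoment hdrift
  have hupos : ∀ t x, 0 < u t x := fun t x => zero_lt_one.trans_le (one_le_u t x)
  have hbound : ∀ (h : ℝ≥0 → ℝ) (K : ℝ), 0 ≤ K → (∀ z, |h z| ≤ K * u (s - 1) z) →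
      ∀ x, green ρ (fun z => ENNReal.ofReal |h z|) x ≤ ENNReal.ofReal (K * C * u s x) := by
    intro h K hK hle x
    have hle' : (fun z => ENNReal.ofReal |h z|) ≤
        fun z => ENNReal.ofReal K * ENNReal.ofReal (u (s - 1) z) := fun z => by
      beta_reduce
      rw [← ENNReal.ofReal_mul hK]
      exact ENNReal.ofReal_le_ofReal (hle z)
    refine (green_mono ρ hle' x).trans ?_
    rw [green_const_mul ρ _ (measurable_u _).ennreal_ofReal, mul_assoc K, ENNReal.ofReal_mul hK]
    gcongr
    exact hC x
  -- Since `1 ≤ u (s - 1)`, the mean of `τ` is finite from every starting point.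
  have hone : ∀ x, green ρ (fun _ => 1) x ≠ ⊤ := fun x => by
    have h := hbound (fun _ => 1) 1 zero_le_one
      (fun z => by rw [abs_one, one_mul]; exact one_le_u _ z) x
    simp only [abs_one, ENNReal.ofReal_one] at h
    exact ne_top_of_le_ne_top ENNReal.ofReal_ne_top h
  have hprob := isProbabilityMeasure_mu ρ (hone 0)
  refine ⟨hprob, invariant_mu ρ (hone 0), fun f hf => ?_⟩
  obtain ⟨K, hK0, hK⟩ := abs_le_mul_of_mem_weightedSpace (hupos _) hf
  have hfint : Integrable f (mu ρ) := by
    refine ⟨hf.1.aestronglyMeasurable, ?_⟩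
    rw [hasFiniteIntegral_iff_norm]
    simp only [Real.norm_eq_abs]
    rw [lintegral_mu ρ hf.1.abs.ennreal_ofReal]
    exact ENNReal.mul_lt_top
      (ENNReal.inv_lt_top.2 (zero_lt_one.trans_le (one_le_green_one ρ 0)))
      ((hbound f K hK0 hK 0).trans_lt ENNReal.ofReal_lt_top)
  set m := ∫ z, f z ∂(mu ρ) with hm
  have hhm : Measurable fun x => f x - m := hf.1.sub_const m
  have hhK : ∀ z, |f z - m| ≤ (K + |m|) * u (s - 1) z := fun z => by
    have h1 := abs_sub (f z) m
    have h2 := mul_le_mul_of_nonneg_left (one_le_u (s - 1) z) (abs_nonneg m)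
    have h3 := hK z
    linarith
  have hK1 : 0 ≤ K + |m| := by positivity
  have hfin : ∀ x, green ρ (fun z => ENNReal.ofReal |f z - m|) x ≠ ⊤ := fun x =>
    ne_top_of_le_ne_top ENNReal.ofReal_ne_top (hbound _ _ hK1 hhK x)
  have hpoisson := poisson_of_integral_eq_zero ρ hhm hone hfin
    (hfint.sub (integrable_const m))
    (by rw [integral_sub hfint (integrable_const m)]; simp [hm])
  refine ⟨hfint, fun x => ?_, R ρ fun x => f x - m, ⟨?_, ?_⟩, rfl, fun x => (hpoisson x).1,
    fun x => by linarith [(hpoisson x).2]⟩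
  · exact integrableOn_excursionSum ρ hhm.abs (fun z => abs_nonneg _) (hone x) (hfin x)
  · have hR : R ρ (fun x => f x - m) =
        fun x => (green ρ (fun z => ENNReal.ofReal (f z - m)) x).toReal -
          (green ρ (fun z => ENNReal.ofReal (-(f z - m))) x).toReal :=
      funext fun z => R_eq_sub ρ hhm (hone z) (hfin z)
    rw [hR]
    exact (measurable_green ρ hhm.ennreal_ofReal).ennreal_toReal.sub
      (measurable_green ρ hhm.neg.ennreal_ofReal).ennreal_toReal
  · refine ⟨(K + |m|) * C, ?_⟩
    rintro _ ⟨x, rfl⟩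
    simp only [Real.rpow_one]
    rw [div_le_iff₀ (hupos s x), R_eq_sub ρ hhm (hone x) (hfin x)]
    -- Both potentials lie between `0` and the same bound, hence so does the absolute value of their
    -- difference.
    have hle : ∀ r : ℝ≥0 → ℝ, (∀ z, r z ≤ |f z - m|) →
        (green ρ (fun z => ENNReal.ofReal (r z)) x).toReal ≤ (K + |m|) * C * u s x :=
      fun r hr => ENNReal.toReal_le_of_le_ofReal
        (mul_nonneg (mul_nonneg hK1 hC0) (hupos s x).le)
        ((green_mono ρ (fun z => ENNReal.ofReal_le_ofReal (hr z)) x).trans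
          (hbound _ _ hK1 hhK x))
    have hA := hle _ fun z => le_abs_self _
    have hB := hle _ fun z => neg_le_abs _
    have hA0 := (green ρ (fun z => ENNReal.ofReal (f z - m)) x).toReal_nonneg
    have hB0 := (green ρ (fun z => ENNReal.ofReal (-(f z - m))) x).toReal_nonneg
    rw [abs_le]
    constructor <;> linarith
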